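/- Let $0<p<1$ and $q=1-p$. Let $X_1,X_2,\dots$ be independent random variables, uniformly distributed on $[0,1]$, and let $N$ be a random variable, independent of the sequence $(X_i)$, with $\mathbf P(N=k)=pq^{k-1}$ for $k=1,2,\dots$. The $k$-th object has value $X_k$ and is available iff $k\le N$. At stage $k$ the decision maker knows $X_1,\dots,X_k$ and the indicators of the events $\{N\ge 1\},\dots,\{N\ge k\}$; stopping times $\tau$ (with values in $\{1,2,\dots\}\cup\{\infty\}$) are taken with respect to this filtration. A candidate is a relative maximum, i.e. an object $k$ with $X_k=\max\{X_1,\dots,X_k\}$. For $1\le k\le N$ and $x\in[0,1]$ let $$D_k(x)=1+\sum_{i=k+1}^{N}\prod_{j=k+1}^{i}\mathbf 1_{\{X_j<x\}}$$ be the duration for which a candidate of value $x$ selected at stage $k$ is held. The payoff of $\tau$ is $D_\tau(X_\tau)$ if $\tau\le N$ and object $\tau$ is a candidate, and $0$ otherwise. Let $v^\star$ be the supremum of the expected payoff over all stopping times; a stopping time is optimal if it attains $v^\star$. A state is a pair $(k,x)$ with $k\ge1$ and $x\in[0,1]$, meaning that $N\ge k$ and that object $k$ is a candidate of value $x$. Let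 $s_k(x)=\mathbf E[D_k(x)\mid N\ge k]$ be the expected payoff of stopping in state $(k,x)$. Let $c_k(x)$ be the supremum, over stopping times $\tau>k$, of the conditional expectation given $N\ge k$ of the payoff of $\tau$ when the running maximum at stage $k$ is $x$ (so that object $j>k$ is a candidate iff $X_j\ge\max\{x,X_{k+1},\dots,X_j\}$). The optimal stopping region is the set of states with $s_k(x)\ge c_k(x)$. (i) If $p\le e^{-1}$, put $x_0=\frac{1-ep}{q}$. Then $0\le x_0<1$, with $x_0>0$ if $p<e^{-1}$; the optimal stopping region is $\{(k,x): x\ge x_0\}$; the rule that selects the first available candidate of value at least $x_0$ is an optimal stopping time; and $$v^\star=\frac{x_0}{1-qx_0}-\frac1q\ln\frac{1-q}{1-qx_0}.$$ (ii) If $p>e^{-1}$, the optimal stopping region is the whole state space, stopping at the first observation is optimal, and $$v^\star=-\frac1q\ln(1-q).$$ -/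

import Mathlib

open MeasureTheory ProbabilityTheory
open scoped ENNReal

noncomputable section

namespace GeomDuration

variable {Ω : Type*} [MeasurableSpace Ω]

/-- The objects are indexed from `0`: `X i` is the value of the `(i+1)`-st object, and this object
is available iff `i < N`, where `N` is the (random) number of objects.

`info` is the information available to the decision maker: at stage `i` the values
`X 0, …, X i` and the indicators of the events "object `j` is available", `j ≤ i`, are known. -/
def info (X : ℕ → Ω → ℝ) (N : Ω → ℕ) (hX : ∀ i, Measurable (X i)) (hN : Measurable N) :
    Filtration ℕ (inferInstance : MeasurableSpace Ω) :=
  Filtration.natural (fun i ω => (X i ω, if i < N ω then (1 : ℝ) else 0)) fun i =>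
    ((hX i).prodMk (Measurable.ite (hN measurableSet_Ioi) measurable_const
      measurable_const)).stronglyMeasurable

/-- Object `i` is a candidate (a relative maximum). -/
def IsCandidate (X : ℕ → Ω → ℝ) (i : ℕ) (ω : Ω) : Prop := ∀ j ≤ i, X j ω ≤ X i ω

open Classical in
/-- The time during which an available candidate of value `x` at stage `i` is held: until the
first larger value or until the last stage of the horizon, i.e.
`1 + ∑_{i < j < N} ∏_{i < l ≤ j} 1{X_l < x}`. -/
def duration (X : ℕ → Ω → ℝ) (N : Ω → ℕ) (i : ℕ) (x : ℝ) (ω : Ω) : ℝ≥0∞ :=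
  1 + ∑ j ∈ Finset.Ioo i (N ω), ∏ l ∈ Finset.Ioc i j, if X l ω < x then 1 else 0

open Classical in
/-- The payoff of a stopping rule `τ`: the duration of the selected object if that object is an
available candidate; `0` if it is not, or if `τ` never stops. -/
def payoff (X : ℕ → Ω → ℝ) (N : Ω → ℕ) (τ : Ω → WithTop ℕ) (ω : Ω) : ℝ≥0∞ :=
  WithTop.recTopCoe 0
    (fun i => if i < N ω ∧ IsCandidate X i ω then duration X N i (X i ω) ω else 0) (τ ω)

/-- The value of the problem: the supremum of the expected payoff over all stopping times. -/
def value (P : Measure Ω) (X : ℕ → Ω → ℝ) (N : Ω → ℕ)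
    (hX : ∀ i, Measurable (X i)) (hN : Measurable N) : ℝ≥0∞ :=
  ⨆ (τ : Ω → WithTop ℕ) (_ : IsStoppingTime (info X N hX hN) τ), ∫⁻ ω, payoff X N τ ω ∂P

/-- `τ` is an optimal stopping time. -/
def IsOptimal (P : Measure Ω) (X : ℕ → Ω → ℝ) (N : Ω → ℕ)
    (hX : ∀ i, Measurable (X i)) (hN : Measurable N) (τ : Ω → WithTop ℕ) : Prop :=
  IsStoppingTime (info X N hX hN) τ ∧ ∫⁻ ω, payoff X N τ ω ∂P = value P X N hX hN

/-- `s_k(x)`: the expected payoff of stopping in state `(k, x)`, i.e. when object `k` is available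
and is a candidate of value `x`. -/
def stopValue (P : Measure Ω) (X : ℕ → Ω → ℝ) (N : Ω → ℕ) (k : ℕ) (x : ℝ) : ℝ≥0∞ :=
  ∫⁻ ω, duration X N k x ω ∂P[|{ω | k < N ω}]

open Classical in
/-- The payoff of a rule `τ` that passes over the candidate in state `(k, x)`. The largest value up
to stage `k` being `x`, a later object `j` is a candidate iff its value is at least `x` and at least
the values at the stages in `(k, j]`. -/
def contPayoff (X : ℕ → Ω → ℝ) (N : Ω → ℕ) (k : ℕ) (x : ℝ) (τ : Ω → WithTop ℕ) (ω : Ω) : ℝ≥0∞ :=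
  WithTop.recTopCoe 0
    (fun j => if j < N ω ∧ x ≤ X j ω ∧ (∀ l, k < l → l ≤ j → X l ω ≤ X j ω) then
      duration X N j (X j ω) ω else 0) (τ ω)

/-- `c_k(x)`: the optimal expected payoff of continuing from state `(k, x)`. -/
def contValue (P : Measure Ω) (X : ℕ → Ω → ℝ) (N : Ω → ℕ)
    (hX : ∀ i, Measurable (X i)) (hN : Measurable N) (k : ℕ) (x : ℝ) : ℝ≥0∞ :=
  ⨆ (τ : Ω → WithTop ℕ) (_ : IsStoppingTime (info X N hX hN) τ ∧ ∀ ω, (k : WithTop ℕ) < τ ω),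
    ∫⁻ ω, contPayoff X N k x τ ω ∂P[|{ω | k < N ω}]

/-- The states `(k, x)`: stage and value of the current candidate. -/
def states : Set (ℕ × ℝ) := {s | s.2 ∈ Set.Icc (0 : ℝ) 1}

/-- The optimal stopping region: the states in which stopping is at least as good as continuing
in an optimal manner. -/
def stoppingRegion (P : Measure Ω) (X : ℕ → Ω → ℝ) (N : Ω → ℕ)
    (hX : ∀ i, Measurable (X i)) (hN : Measurable N) : Set (ℕ × ℝ) :=
  {s ∈ states | contValue P X N hX hN s.1 s.2 ≤ stopValue P X N s.1 s.2}

open Classical in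
/-- The rule: select the first available candidate of value at least `a` (never stop if there is
none). -/
def threshold (X : ℕ → Ω → ℝ) (N : Ω → ℕ) (a : ℝ) (ω : Ω) : WithTop ℕ :=
  if h : ∃ i, i < N ω ∧ IsCandidate X i ω ∧ a ≤ X i ω then ((Nat.find h : ℕ) : WithTop ℕ) else ⊤

end GeomDuration

end

/-! Write `S(x) = 1/(1 - qx)` and `T(a)` for the integral of `S` over `[a, 1]`. While the horizon
lasts, the available information is that of the past values, which are independent of `N`. Each
further stage survives with probability `q`, so holding a candidate of value `x` is worth the
geometric series `S(x)` at every stage (`lintegral_mul_duration`). The payoff of any rule thus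
becomes a sum of stagewise rewards with the duration replaced by `S` (`lintegral_gain`).

Passing over a candidate and taking the next value at least `a` is worth `q T(a) S(a)` when `a` is
at least the current maximum (`lintegral_gain_first`). For `a` equal to that maximum `x`, this is at
most `S(x)` iff `q T(x) ≤ 1`. Since `T` decreases, the condition persists as the maximum grows: this
is the monotone case. Explicitly `q T(a) = log((1 - qa)/(1 - q))`, which equals `1` at `a = x₀`; if
`p > 1/e`, it is below `1` already at `a = 0`.

For optimality, `q T(b) S(b)` with `b = max m a` is an excessive function of the running maximum `m`
(`potential_excessive`), so it dominates every continuation (`tsum_reward_le`). With `a = x₀`,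
respectively `a = 0`, the resulting bounds are attained by the stated rules. -/

noncomputable section

namespace GeomDuration

/-! ### The uniform law, the stopping reward and the geometric horizon -/

/-- The uniform distribution on `[0, 1]`. -/
def unif : Measure ℝ := volume.restrict (Set.Icc 0 1)

instance : IsProbabilityMeasure unif := ⟨by simp [unif]⟩

/-- The distribution function of the uniform distribution. -/
def cdf01 (x : ℝ) : ℝ≥0∞ := unif (Set.Iio x)

lemma cdf01_mono : Monotone cdf01 := fun _ _ h => measure_mono (Set.Iio_subset_Iio h)

@[fun_prop]
lemma measurable_cdf01 : Measurable cdf01 := cdf01_mono.measurable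

/-- The value of stopping with a candidate of value `x`. -/
def stopFun (Q : ℝ≥0∞) (x : ℝ) : ℝ≥0∞ := (1 - Q * cdf01 x)⁻¹

lemma stopFun_mono (Q : ℝ≥0∞) : Monotone (stopFun Q) := fun _ _ h =>
  ENNReal.inv_le_inv.mpr (tsub_le_tsub_left (mul_le_mul_right (cdf01_mono h) _) _)

@[fun_prop]
lemma measurable_stopFun (Q : ℝ≥0∞) : Measurable (stopFun Q) := (stopFun_mono Q).measurable

/-- The sequence `X` is independent and uniformly distributed on `[0, 1]`, and independent of the
horizon `N`, whose tail is geometric with ratio `Q`. -/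
structure Model {Ω : Type*} [MeasurableSpace Ω] (P : Measure Ω) (X : ℕ → Ω → ℝ) (N : Ω → ℕ)
    (Q : ℝ≥0∞) : Prop where
  measurable_X : ∀ i, Measurable (X i)
  measurable_N : Measurable N
  map_X : ∀ i, P.map (X i) = unif
  indep : iIndepFun X P
  tail : ∀ n, P {ω | n < N ω} = Q ^ n
  indep_N : IndepFun N (fun ω i => X i ω) P

variable {Ω : Type*} [MeasurableSpace Ω] {P : Measure Ω} [IsProbabilityMeasure P]
  {X : ℕ → Ω → ℝ} {N : Ω → ℕ} {Q : ℝ≥0∞}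

/-! ### Information on the event that the horizon lasts -/

/-- The filtration generated by the values. -/
def hist (X : ℕ → Ω → ℝ) (hX : ∀ i, Measurable (X i)) :
    Filtration ℕ (inferInstance : MeasurableSpace Ω) :=
  Filtration.natural X fun i => (hX i).stronglyMeasurable

lemma measurable_hist (hX : ∀ i, Measurable (X i)) {i j : ℕ} (hij : i ≤ j) :
    Measurable[hist X hX j] (X i) := by
  refine Measurable.of_comap_le ?_
  exact le_iSup₂_of_le (f := fun j' _ => MeasurableSpace.comap (X j') _) i hij le_rfl

lemma hist_le_comap (hX : ∀ i, Measurable (X i)) (j : ℕ) :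
    hist X hX j ≤ MeasurableSpace.comap (fun ω i => X i ω) inferInstance := by
  refine iSup₂_le fun i _ => ?_
  rintro _ ⟨t, ht, rfl⟩
  exact ⟨(fun x : ℕ → ℝ => x i) ⁻¹' t, measurable_pi_apply i ht, rfl⟩

lemma measurableSet_info_lt (hX : ∀ i, Measurable (X i)) (hN : Measurable N) {i j : ℕ}
    (hij : i ≤ j) {s : Set ℝ} (hs : MeasurableSet s) :
    MeasurableSet[info X N hX hN j] {ω | i < N ω ∧ X i ω ∈ s} := by
  have : MeasurableSpace.comap (fun ω => (X i ω, if i < N ω then (1 : ℝ) else 0)) inferInstance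
      ≤ info X N hX hN j := by
    exact le_iSup₂_of_le (f := fun j' _ => MeasurableSpace.comap
      (fun ω => (X j' ω, if j' < N ω then (1 : ℝ) else 0)) _) i hij le_rfl
  refine this _ ⟨s ×ˢ {1}, hs.prod (measurableSet_singleton _), ?_⟩
  ext ω
  by_cases h : i < N ω <;> simp [h]

/-- The sets that agree on `{j < N}` with an event of the past values. -/
@[reducible]
def traceSpace (hX : ∀ i, Measurable (X i)) (N : Ω → ℕ) (j : ℕ) : MeasurableSpace Ω where
  MeasurableSet' B := ∃ B', MeasurableSet[hist X hX j] B' ∧ ∀ ω, j < N ω → (ω ∈ B ↔ ω ∈ B')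
  measurableSet_empty := ⟨∅, @MeasurableSet.empty _ (hist X hX j), fun _ _ => Iff.rfl⟩
  measurableSet_compl := by
    rintro s ⟨B', h1, h2⟩
    exact ⟨B'ᶜ, h1.compl, fun ω h => not_congr (h2 ω h)⟩
  measurableSet_iUnion := by
    intro f hf
    choose g h1 h2 using hf
    refine ⟨⋃ i, g i, @MeasurableSet.iUnion _ _ (hist X hX j) _ _ h1, fun ω h => ?_⟩
    simp only [Set.mem_iUnion, h2 _ ω h]

/-- While the horizon lasts, the information consists of the past values. -/
lemma exists_hist_of_info (hX : ∀ i, Measurable (X i)) (hN : Measurable N) (j : ℕ) {B : Set Ω}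
    (hB : MeasurableSet[info X N hX hN j] B) :
    ∃ B', MeasurableSet[hist X hX j] B' ∧ ∀ ω, j < N ω → (ω ∈ B ↔ ω ∈ B') := by
  -- The sets of `traceSpace` form a σ-algebra, so only generators need checking; on `{j < N}` all
  -- indicators up to stage `j` equal `1`, hence the constant second coordinate below.
  have : info X N hX hN j ≤ traceSpace hX N j := by
    refine iSup₂_le fun i hij => ?_
    rintro _ ⟨t, ht, rfl⟩
    refine ⟨(fun ω => (X i ω, (1 : ℝ))) ⁻¹' t, ?_, fun ω h => ?_⟩
    · exact (Measurable.prodMk (measurable_hist hX hij) measurable_const) ht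
    · have h' : i < N ω := lt_of_le_of_lt hij h
      simp [h']
  exact this _ hB

/-- The indicator of the event that object `n` is available. -/
def avail (N : Ω → ℕ) (n : ℕ) (ω : Ω) : ℝ≥0∞ := if n < N ω then 1 else 0

lemma measurable_avail (hN : Measurable N) (n : ℕ) : Measurable (avail N n) :=
  Measurable.ite (hN measurableSet_Ioi) measurable_const measurable_const

/-! ### Integrating out the horizon and the future values -/

namespace Model

variable (M : Model P X N Q)
include M

omit [IsProbabilityMeasure P] in
-- Independence of `N` from the whole sequence `X` splits off the tail probability. The stages `j`
-- and `n` are unrelated, so `f` may look beyond stage `n`.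
lemma lintegral_mul_avail {j : ℕ} {f : Ω → ℝ≥0∞} (hf : Measurable[hist X M.measurable_X j] f)
    (n : ℕ) : ∫⁻ ω, f ω * avail N n ω ∂P = Q ^ n * ∫⁻ ω, f ω ∂P := by
  have h := lintegral_mul_eq_lintegral_mul_lintegral_of_independent_measurableSpace
    (μ := P) (f := f) (g := avail N n)
    (Measurable.comap_le (measurable_pi_lambda _ M.measurable_X)) M.measurable_N.comap_le
    M.indep_N.symm (hf.mono (hist_le_comap M.measurable_X j) le_rfl)
    (Measurable.ite (measurableSet_Ioi.preimage (comap_measurable N)) measurable_const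
      measurable_const)
  rw [h, mul_comm]
  congr 1
  have : avail N n = Set.indicator {ω | n < N ω} 1 := by
    ext ω; simp [avail, Set.indicator]
  have hs : MeasurableSet {ω | n < N ω} := M.measurable_N measurableSet_Ioi
  rw [this, lintegral_indicator_one hs]
  exact M.tail n

/-- Integrating out a value independent of the past. -/
lemma lintegral_next {β : Type*} [MeasurableSpace β] {j l : ℕ} (hjl : j < l) {Z : Ω → β}
    (hZ : Measurable[hist X M.measurable_X j] Z) {h : β → ℝ → ℝ≥0∞}
    (hh : Measurable (Function.uncurry h)) :
    ∫⁻ ω, h (Z ω) (X l ω) ∂P = ∫⁻ ω, ∫⁻ y, h (Z ω) y ∂unif ∂P := by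
  have hZ' : Measurable Z := hZ.mono ((hist X M.measurable_X).le j) le_rfl
  have hi : IndepFun Z (X l) P := by
    have := iIndepFun.indep_comap_natural_of_lt (fun i => (M.measurable_X i).stronglyMeasurable)
      M.indep hjl
    exact indep_of_indep_of_le_left this.symm hZ.comap_le
  have hmap := hi.map_prod_eq_prod_map_map hZ'.aemeasurable (M.measurable_X l).aemeasurable
  have h1 : ∫⁻ ω, h (Z ω) (X l ω) ∂P
      = ∫⁻ z, Function.uncurry h z ∂(P.map fun ω => (Z ω, X l ω)) := by
    rw [lintegral_map hh (hZ'.prodMk (M.measurable_X l))]; rfl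
  have : IsProbabilityMeasure (P.map Z) := Measure.isProbabilityMeasure_map hZ'.aemeasurable
  rw [h1, hmap, M.map_X, lintegral_prod _ hh.aemeasurable, lintegral_map _ hZ']
  · rfl
  · exact hh.lintegral_prod_right'

open Classical in
-- Induction on `n`, integrating out the latest value first. The factor `cdf01 (Y ω)` so produced is
-- known at stage `j` and is absorbed into `f`, which is why `f` is generalized.
lemma lintegral_mul_prod {j : ℕ} (n : ℕ) {f : Ω → ℝ≥0∞} {Y : Ω → ℝ}
    (hf : Measurable[hist X M.measurable_X j] f) (hY : Measurable[hist X M.measurable_X j] Y) :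
    ∫⁻ ω, f ω * ∏ l ∈ Finset.Ioc j (j + n), (if X l ω < Y ω then 1 else 0) ∂P
      = ∫⁻ ω, f ω * cdf01 (Y ω) ^ n ∂P := by
  induction n generalizing f with
  | zero => simp
  | succ n ih =>
    have hY' : Measurable[hist X M.measurable_X (j + n)] Y :=
      hY.mono ((hist X M.measurable_X).mono (by omega)) le_rfl
    have hg : Measurable[hist X M.measurable_X (j + n)] fun ω => f ω *
        ∏ l ∈ Finset.Ioc j (j + n), (if X l ω < Y ω then (1 : ℝ≥0∞) else 0) := by
      refine Measurable.mul (hf.mono ((hist X M.measurable_X).mono (by omega)) le_rfl) ?_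
      refine Finset.measurable_prod _ fun l hl => ?_
      refine Measurable.ite ?_ measurable_const measurable_const
      exact measurableSet_lt (measurable_hist _ (Finset.mem_Ioc.mp hl).2) hY'
    have := M.lintegral_next (l := j + (n + 1)) (by omega) (hg.prodMk hY')
      (h := fun z y => z.1 * if y < z.2 then 1 else 0) (by
        refine Measurable.mul (by fun_prop) (Measurable.ite ?_ measurable_const measurable_const)
        exact measurableSet_lt (by fun_prop) (by fun_prop))
    simp only at this
    have e (ω : Ω) : ∏ l ∈ Finset.Ioc j (j + (n + 1)), (if X l ω < Y ω then (1 : ℝ≥0∞) else 0)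
        = (∏ l ∈ Finset.Ioc j (j + n), (if X l ω < Y ω then (1 : ℝ≥0∞) else 0)) *
          (if X (j + (n + 1)) ω < Y ω then 1 else 0) := by
      rw [← add_assoc, Finset.prod_Ioc_succ_top (by omega)]
    simp_rw [e, ← mul_assoc]
    rw [this]
    have e2 (z : ℝ≥0∞) (x : ℝ) : ∫⁻ y, z * (if y < x then 1 else 0) ∂unif = z * cdf01 x := by
      rw [lintegral_const_mul _ (Measurable.ite measurableSet_Iio measurable_const
        measurable_const), cdf01, ← lintegral_indicator_one measurableSet_Iio]
      simp [Set.indicator]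
    simp_rw [e2]
    have := ih (f := fun ω => f ω * cdf01 (Y ω)) (hf.mul (measurable_cdf01.comp hY))
    simp_rw [mul_right_comm _ _ (cdf01 _), this, pow_succ', mul_assoc]

omit M [MeasurableSpace Ω] in
open Classical in
-- Moving the random horizon from the range of summation into the factors `avail` leaves a series
-- whose terms can be integrated one by one.
lemma avail_mul_duration (k : ℕ) (x : ℝ) (ω : Ω) : avail N k ω * duration X N k x ω =
    ∑' n, (∏ l ∈ Finset.Ioc k (k + n), if X l ω < x then 1 else 0) * avail N (k + n) ω := by
  by_cases h : k < N ω
  · rw [tsum_eq_sum (s := Finset.range (N ω - k))]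
    · obtain ⟨m, hm⟩ : ∃ m, N ω - k = m + 1 := ⟨N ω - k - 1, by omega⟩
      -- The term `n = 0` of the series is the leading `1` of the duration, so the later stages are
      -- matched with indices shifted by one.
      have h2 : Finset.Ioo k (N ω) = (Finset.range m).image (fun i => k + (i + 1)) := by
        ext i
        simp only [Finset.mem_Ioo, Finset.mem_image, Finset.mem_range]
        exact ⟨fun hi => ⟨i - k - 1, by omega, by omega⟩, by rintro ⟨a, ha, rfl⟩; omega⟩
      rw [hm, Finset.sum_range_succ', duration, h2, Finset.sum_image (by intro a _ b _; simp)]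
      simp only [avail, h, if_true, add_zero, Finset.Ioc_self, Finset.prod_empty, one_mul]
      rw [add_comm]
      congr 1
      refine Finset.sum_congr rfl fun i hi => ?_
      have : k + (i + 1) < N ω := by have := Finset.mem_range.mp hi; omega
      simp [this]
    · intro n hn
      have : ¬ k + n < N ω := by simp at hn; omega
      simp [avail, this]
  · have (n : ℕ) : ¬ k + n < N ω := by omega
    simp [avail, h, this]

omit [IsProbabilityMeasure P] in
lemma measurable_avail_mul_duration {k : ℕ} {Y : Ω → ℝ} (hY : Measurable Y) :
    Measurable fun ω => avail N k ω * duration X N k (Y ω) ω := by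
  simp_rw [avail_mul_duration]
  refine Measurable.tsum fun n => Measurable.mul (Finset.measurable_prod _ fun l _ => ?_)
    (measurable_avail M.measurable_N _)
  exact Measurable.ite (measurableSet_lt (M.measurable_X l) hY) measurable_const measurable_const

/-- The `n`-th term of the duration series contributes `Q ^ (k + n) * cdf01 (Y ω) ^ n`; the
geometric series sums to `stopFun`. -/
lemma lintegral_mul_duration {k : ℕ} {f : Ω → ℝ≥0∞} {Y : Ω → ℝ}
    (hf : Measurable[hist X M.measurable_X k] f) (hY : Measurable[hist X M.measurable_X k] Y) :
    ∫⁻ ω, f ω * (avail N k ω * duration X N k (Y ω) ω) ∂P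
      = Q ^ k * ∫⁻ ω, f ω * stopFun Q (Y ω) ∂P := by
  classical
  have hf' : Measurable f := hf.mono ((hist X M.measurable_X).le k) le_rfl
  have hY' : Measurable Y := hY.mono ((hist X M.measurable_X).le k) le_rfl
  have hp (n : ℕ) : Measurable[hist X M.measurable_X (k + n)] fun ω => f ω *
      ∏ l ∈ Finset.Ioc k (k + n), (if X l ω < Y ω then (1 : ℝ≥0∞) else 0) := by
    refine Measurable.mul (hf.mono ((hist X M.measurable_X).mono (by omega)) le_rfl) ?_
    refine Finset.measurable_prod _ fun l hl => ?_
    refine Measurable.ite ?_ measurable_const measurable_const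
    exact measurableSet_lt (measurable_hist _ (Finset.mem_Ioc.mp hl).2)
      (hY.mono ((hist X M.measurable_X).mono (by omega)) le_rfl)
  simp_rw [avail_mul_duration, ← ENNReal.tsum_mul_left, ← mul_assoc]
  rw [lintegral_tsum (f := fun n ω => (f ω * _) * avail N (k + n) ω) fun n => (((hp n).mono ((hist X M.measurable_X).le _) le_rfl).mul
    (measurable_avail M.measurable_N _)).aemeasurable]
  simp_rw [M.lintegral_mul_avail (hp _), M.lintegral_mul_prod _ hf hY, pow_add, mul_assoc]
  rw [ENNReal.tsum_mul_left]
  congr 1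
  have (n : ℕ) : Q ^ n * ∫⁻ ω, f ω * cdf01 (Y ω) ^ n ∂P
      = ∫⁻ ω, f ω * (Q * cdf01 (Y ω)) ^ n ∂P := by
    rw [← lintegral_const_mul _ (by fun_prop)]
    refine lintegral_congr fun ω => ?_
    rw [mul_pow]; ring
  simp_rw [this]
  rw [← lintegral_tsum fun n => by fun_prop]
  simp_rw [ENNReal.tsum_mul_left, ENNReal.tsum_geometric]
  rfl

end Model

/-! ### The expected payoff as a sum of stagewise rewards -/

open Classical in
/-- The payoff of `τ` when `K i` is the event that object `i` is a candidate. -/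
def gain (X : ℕ → Ω → ℝ) (N : Ω → ℕ) (K : ℕ → Ω → Prop) (τ : Ω → WithTop ℕ) (ω : Ω) : ℝ≥0∞ :=
  WithTop.recTopCoe 0
    (fun i => if i < N ω ∧ K i ω then duration X N i (X i ω) ω else 0) (τ ω)

/-- The event that `τ` stops at the candidate `i`. -/
def stopAt (K : ℕ → Ω → Prop) (τ : Ω → WithTop ℕ) (i : ℕ) : Set Ω := {ω | τ ω = WithTop.some i ∧ K i ω}

/-- The expected reward collected by `τ` at stage `i`. -/
def reward (P : Measure Ω) (X : ℕ → Ω → ℝ) (N : Ω → ℕ) (Q : ℝ≥0∞) (K : ℕ → Ω → Prop)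
    (τ : Ω → WithTop ℕ) (i : ℕ) : ℝ≥0∞ :=
  ∫⁻ ω, (stopAt K τ i).indicator 1 ω * stopFun Q (X i ω) * avail N i ω ∂P

omit [MeasurableSpace Ω] in
lemma gain_eq_tsum (K : ℕ → Ω → Prop) (τ : Ω → WithTop ℕ) (ω : Ω) : gain X N K τ ω =
    ∑' i, (stopAt K τ i).indicator 1 ω * (avail N i ω * duration X N i (X i ω) ω) := by
  classical
  rw [gain]
  rcases h : τ ω with _ | i
  · have (i : ℕ) : ω ∉ stopAt K τ i := fun h' => by
      have := h.symm.trans h'.1; exact absurd this (WithTop.top_ne_coe)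
    simp only [this, not_false_eq_true, Set.indicator_of_notMem, zero_mul, tsum_zero]
    rfl
  · have h' : τ ω = WithTop.some i := h
    change (if i < N ω ∧ K i ω then duration X N i (X i ω) ω else 0) = _
    rw [tsum_eq_single i]
    · by_cases h1 : i < N ω <;> by_cases h2 : K i ω <;>
        simp [stopAt, h', h1, h2, avail, Set.indicator]
    · intro j hj
      have : ω ∉ stopAt K τ j := fun h'' => hj (by
        have := h'.symm.trans h''.1; exact (WithTop.coe_injective this).symm)
      simp [this]

namespace Model

variable (M : Model P X N Q)
include M

omit [IsProbabilityMeasure P] in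
/-- While the horizon lasts, the indicator of an observable event depends on the past values. -/
lemma exists_indicator_eq {j : ℕ} {B : Set Ω}
    (hB : MeasurableSet[info X N M.measurable_X M.measurable_N j] B) :
    ∃ B', MeasurableSet[hist X M.measurable_X j] B' ∧
      ∀ ω, j < N ω → (B.indicator (1 : Ω → ℝ≥0∞) ω = B'.indicator 1 ω) := by
  obtain ⟨B', h1, h2⟩ := exists_hist_of_info M.measurable_X M.measurable_N j hB
  refine ⟨B', h1, fun ω h => ?_⟩
  by_cases hω : ω ∈ B
  · rw [Set.indicator_of_mem hω, Set.indicator_of_mem ((h2 ω h).mp hω)]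
  · rw [Set.indicator_of_notMem hω, Set.indicator_of_notMem (fun h' => hω ((h2 ω h).mpr h'))]

/-- On `{i < N}` the event of stopping at `i` agrees with an event of the past values, so the
duration may be replaced by its conditional expectation; the replacement is then undone to recover
the original stopping event. -/
lemma lintegral_gain {K : ℕ → Ω → Prop}
    (hK : ∀ i, MeasurableSet[hist X M.measurable_X i] {ω | K i ω}) {τ : Ω → WithTop ℕ}
    (hτ : IsStoppingTime (info X N M.measurable_X M.measurable_N) τ) :
    ∫⁻ ω, gain X N K τ ω ∂P = ∑' i, reward P X N Q K τ i := by
  simp_rw [gain_eq_tsum]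
  have hs (i : ℕ) : MeasurableSet (stopAt K τ i) :=
    ((info X N M.measurable_X M.measurable_N).le i _ (hτ.measurableSet_eq i)).inter
      ((hist X M.measurable_X).le i _ (hK i))
  rw [lintegral_tsum fun i => ((measurable_one.indicator (hs i)).fun_mul
    (M.measurable_avail_mul_duration (M.measurable_X i))).aemeasurable]
  congr 1
  ext i
  obtain ⟨B, hB, hB'⟩ := M.exists_indicator_eq (hτ.measurableSet_eq i)
  have key (ω : Ω) (hω : i < N ω) : (stopAt K τ i).indicator (1 : Ω → ℝ≥0∞) ω
      = (B ∩ {ω | K i ω}).indicator 1 ω := by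
    have := hB' ω hω
    change ({ω | τ ω = WithTop.some i} ∩ {ω | K i ω}).indicator (1 : Ω → ℝ≥0∞) ω = _
    rw [Set.inter_indicator_one, Set.inter_indicator_one, Pi.mul_apply, Pi.mul_apply, this]
  have hm : Measurable[hist X M.measurable_X i]
      ((B ∩ {ω | K i ω}).indicator (1 : Ω → ℝ≥0∞)) :=
    measurable_const.indicator (hB.inter (hK i))
  have hXi := measurable_hist M.measurable_X (le_refl i)
  calc _ = ∫⁻ ω, (B ∩ {ω | K i ω}).indicator 1 ω *
        (avail N i ω * duration X N i (X i ω) ω) ∂P := by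
        refine lintegral_congr fun ω => ?_
        by_cases hω : i < N ω
        · rw [key ω hω]
        · simp [avail, hω]
    _ = ∫⁻ ω, (B ∩ {ω | K i ω}).indicator 1 ω * stopFun Q (X i ω) * avail N i ω ∂P := by
        rw [M.lintegral_mul_duration hm hXi, M.lintegral_mul_avail
          (f := fun ω => _ * stopFun Q (X i ω)) (hm.fun_mul ((measurable_stopFun Q).comp hXi))]
    _ = _ := by
        refine lintegral_congr fun ω => ?_
        by_cases hω : i < N ω
        · rw [key ω hω]
        · simp [avail, hω]

/-! ### Domination by excessive functions -/

/-- Along an excessive function `W` of the running maximum `Z`, the rewards collected after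
stage `k` are dominated by the potential at stage `k`. -/
lemma tsum_reward_le {W : ℝ → ℝ≥0∞} (hWm : Measurable W)
    (hW : ∀ m, Q * ∫⁻ y, (if m ≤ y then max (stopFun Q y) (W y) else W m) ∂unif ≤ W m)
    {K : ℕ → Ω → Prop} {τ : Ω → WithTop ℕ}
    (hτ : IsStoppingTime (info X N M.measurable_X M.measurable_N) τ) {k : ℕ} {Z : ℕ → Ω → ℝ}
    (hZk : Measurable[hist X M.measurable_X k] (Z k))
    (hZ : ∀ n ≥ k, ∀ ω, Z (n + 1) ω = max (Z n ω) (X (n + 1) ω))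
    (hK : ∀ n ≥ k, ∀ ω, K (n + 1) ω → Z n ω ≤ X (n + 1) ω) :
    ∑' n, reward P X N Q K τ (n + (k + 1)) ≤
      ∫⁻ ω, {ω | WithTop.some k < τ ω}.indicator 1 ω * W (Z k ω) * avail N k ω ∂P := by
  have hZm (n : ℕ) (hn : k ≤ n) : Measurable[hist X M.measurable_X n] (Z n) := by
    induction n, hn using Nat.le_induction with
    | base => exact hZk
    | succ n hn ih =>
      rw [show Z (n + 1) = fun ω => max (Z n ω) (X (n + 1) ω) from funext (hZ n hn)]
      exact (ih.mono ((hist X M.measurable_X).mono (by omega)) le_rfl).max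
        (measurable_hist _ le_rfl)
  set e : ℕ → ℝ≥0∞ := fun n =>
    ∫⁻ ω, {ω | WithTop.some n < τ ω}.indicator 1 ω * W (Z n ω) * avail N n ω ∂P with he
  -- The supermartingale inequality: the reward at stage `n + 1` plus the potential left after it is
  -- at most the potential before it.
  have step (n : ℕ) (hn : k ≤ n) : reward P X N Q K τ (n + 1) + e (n + 1) ≤ e n := by
    obtain ⟨B, hB, hB'⟩ := M.exists_indicator_eq (hτ.measurableSet_gt n)
    have hBm : Measurable[hist X M.measurable_X n] (B.indicator (1 : Ω → ℝ≥0∞)) :=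
      measurable_const.indicator hB
    set G : ℝ → ℝ → ℝ≥0∞ := fun m y => if m ≤ y then max (stopFun Q y) (W y) else W m with hG
    have hGm : Measurable (Function.uncurry G) :=
      Measurable.ite (measurableSet_le measurable_fst measurable_snd) (by fun_prop) (by fun_prop)
    calc reward P X N Q K τ (n + 1) + e (n + 1)
        ≤ ∫⁻ ω, B.indicator 1 ω * G (Z n ω) (X (n + 1) ω) * avail N (n + 1) ω ∂P := by
          refine (le_lintegral_add _ _).trans (lintegral_mono fun ω => ?_)
          by_cases hω : n + 1 < N ω
          swap
          · simp [avail, hω]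
          simp only [avail, hω, if_true, mul_one]
          rw [← hB' ω (by omega)]
          -- Stopping at a candidate earns `stopFun`, at a non-candidate nothing; going on leaves
          -- `W` of the new maximum. `G` dominates each outcome.
          by_cases h1 : τ ω = WithTop.some (n + 1)
          · have h2 : ω ∈ {ω | WithTop.some n < τ ω} := by
              change WithTop.some n < τ ω
              rw [h1]; exact WithTop.coe_lt_coe.mpr (Nat.lt_succ_self n)
            have h3 : ω ∉ {ω | WithTop.some (n + 1) < τ ω} := by
              change ¬ WithTop.some (n + 1) < τ ω
              rw [h1]; exact lt_irrefl _
            rw [Set.indicator_of_mem h2, Set.indicator_of_notMem h3]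
            by_cases h4 : K (n + 1) ω
            · have h5 : ω ∈ stopAt K τ (n + 1) := ⟨h1, h4⟩
              rw [Set.indicator_of_mem h5]
              simp [hG, hK n hn ω h4]
            · have h5 : ω ∉ stopAt K τ (n + 1) := fun h => h4 h.2
              simp [h5]
          · have h5 : ω ∉ stopAt K τ (n + 1) := fun h => h1 h.1
            by_cases h3 : ω ∈ {ω | WithTop.some (n + 1) < τ ω}
            · have h2 : ω ∈ {ω | WithTop.some n < τ ω} :=
                lt_trans (WithTop.coe_lt_coe.mpr (Nat.lt_succ_self n)) (show _ < τ ω from h3)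
              rw [Set.indicator_of_mem h2, Set.indicator_of_mem h3, Set.indicator_of_notMem h5,
                hZ n hn]
              by_cases h6 : Z n ω ≤ X (n + 1) ω
              · simp [hG, h6]
              · simp [hG, h6, max_eq_left (not_le.mp h6).le]
            · rw [Set.indicator_of_notMem h3, Set.indicator_of_notMem h5]; simp
      _ = Q ^ (n + 1) * ∫⁻ ω, B.indicator 1 ω * G (Z n ω) (X (n + 1) ω) ∂P := by
          refine M.lintegral_mul_avail (j := n + 1) (Measurable.fun_mul
            (hBm.mono ((hist X M.measurable_X).mono (Nat.le_succ n)) le_rfl) ?_) _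
          exact hGm.comp (((hZm n hn).mono ((hist X M.measurable_X).mono (Nat.le_succ n))
            le_rfl).prodMk (measurable_hist M.measurable_X (le_refl (n + 1))))
      _ = Q ^ (n + 1) * ∫⁻ ω, ∫⁻ y, B.indicator 1 ω * G (Z n ω) y ∂unif ∂P := by
          rw [M.lintegral_next (Nat.lt_succ_self n) (hBm.prodMk (hZm n hn))
            (h := fun z y => z.1 * G z.2 y)]
          exact Measurable.mul (by fun_prop) (hGm.comp (f := fun z : (ℝ≥0∞ × ℝ) × ℝ =>
            (z.1.2, z.2)) (by fun_prop))
      _ = Q ^ n * ∫⁻ ω, B.indicator 1 ω * (Q * ∫⁻ y, G (Z n ω) y ∂unif) ∂P := by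
          have h1 (ω : Ω) : ∫⁻ y, B.indicator 1 ω * G (Z n ω) y ∂unif
              = B.indicator 1 ω * ∫⁻ y, G (Z n ω) y ∂unif :=
            lintegral_const_mul _ (hGm.comp (f := fun y : ℝ => (Z n ω, y)) (by fun_prop))
          have h2 : Measurable fun ω => ∫⁻ y, G (Z n ω) y ∂unif :=
            (hGm.lintegral_prod_right').comp
              ((hZm n hn).mono ((hist X M.measurable_X).le n) le_rfl)
          simp_rw [h1, mul_left_comm _ Q]
          rw [lintegral_const_mul _ ((hBm.mono ((hist X M.measurable_X).le n) le_rfl).fun_mul h2),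
            pow_succ, mul_assoc]
      _ ≤ Q ^ n * ∫⁻ ω, B.indicator 1 ω * W (Z n ω) ∂P := by
          gcongr with ω
          exact hW _
      _ = ∫⁻ ω, B.indicator 1 ω * W (Z n ω) * avail N n ω ∂P :=
          (M.lintegral_mul_avail (hBm.fun_mul (hWm.comp (hZm n hn))) n).symm
      _ = e n := by
          refine lintegral_congr fun ω => ?_
          by_cases hω : n < N ω
          · rw [hB' ω hω]
          · simp [avail, hω]
  -- Telescoping; the leftover potential is nonnegative and can be dropped.
  have sum (m : ℕ) : ∑ n ∈ Finset.range m, reward P X N Q K τ (n + (k + 1)) + e (k + m)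
      ≤ e k := by
    induction m with
    | zero => simp
    | succ m ih =>
      refine le_trans ?_ ih
      rw [Finset.sum_range_succ, add_assoc]
      gcongr
      have := step (k + m) (by omega)
      rwa [show m + (k + 1) = k + m + 1 by ring]
  rw [ENNReal.tsum_eq_iSup_nat]
  exact iSup_le fun m => le_self_add.trans (sum m)

end Model

/-! ### Threshold rules and their expected payoff -/

/-- `τ` selects the first available object, from stage `k` on, of value at least `a`. -/
def IsFirst (X : ℕ → Ω → ℝ) (N : Ω → ℕ) (k : ℕ) (a : ℝ) (τ : Ω → WithTop ℕ) : Prop :=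
  ∀ ω (i : ℕ), τ ω = WithTop.some i ↔ k ≤ i ∧ i < N ω ∧ a ≤ X i ω ∧ ∀ j, k ≤ j → j < i → X j ω < a

lemma IsFirst.isStoppingTime {k : ℕ} {a : ℝ} {τ : Ω → WithTop ℕ} (h : IsFirst X N k a τ)
    (hX : ∀ i, Measurable (X i)) (hN : Measurable N) : IsStoppingTime (info X N hX hN) τ := by
  refine isStoppingTime_of_measurableSet_eq fun i => ?_
  -- Requiring `j < N` for `j < i` costs nothing once `i < N`, and it puts every factor in the form
  -- of `measurableSet_info_lt`.
  have : {ω | τ ω = WithTop.some i} = {ω | i < N ω ∧ X i ω ∈ {x | k ≤ i ∧ a ≤ x}} ∩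
      ⋂ j ∈ Finset.range i, {ω | j < N ω ∧ X j ω ∈ {x | k ≤ j → x < a}} := by
    ext ω
    simp only [Set.mem_ofPred_eq, h ω i, Set.mem_inter_iff, Set.mem_iInter, Finset.mem_range]
    constructor
    · rintro ⟨h1, h2, h3, h4⟩
      exact ⟨⟨h2, h1, h3⟩, fun j hj => ⟨hj.trans h2, fun hk => h4 j hk hj⟩⟩
    · rintro ⟨⟨h2, h1, h3⟩, h4⟩
      exact ⟨h1, h2, h3, fun j hk hj => (h4 j hj).2 hk⟩
  rw [this]
  refine MeasurableSet.inter (measurableSet_info_lt hX hN le_rfl ?_) (Finset.measurableSet_biInter _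
    fun j hj => measurableSet_info_lt hX hN (Finset.mem_range.mp hj).le ?_)
  · exact (MeasurableSet.const (k ≤ i)).inter (measurableSet_Ici : MeasurableSet (Set.Ici a))
  · by_cases hk : k ≤ j
    · simp only [hk, true_imp_iff]
      exact (measurableSet_Iio : MeasurableSet (Set.Iio a))
    · simp [hk]

open Classical in
/-- The rule that selects the first available object, from stage `k` on, of value at least `a`. -/
def firstFrom (X : ℕ → Ω → ℝ) (N : Ω → ℕ) (k : ℕ) (a : ℝ) (ω : Ω) : WithTop ℕ :=
  if h : ∃ i, k ≤ i ∧ i < N ω ∧ a ≤ X i ω then ((Nat.find h : ℕ) : WithTop ℕ) else ⊤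

omit [MeasurableSpace Ω] in
lemma isFirst_firstFrom (k : ℕ) (a : ℝ) : IsFirst X N k a (firstFrom X N k a) := by
  classical
  intro ω i
  rw [firstFrom]
  split_ifs with h
  · refine (WithTop.coe_injective.eq_iff (a := Nat.find h) (b := i)).trans ?_
    rw [Nat.find_eq_iff]
    constructor
    · rintro ⟨⟨h1, h2, h3⟩, h4⟩
      exact ⟨h1, h2, h3, fun j hk hj => not_le.mp fun h' => h4 j hj ⟨hk, hj.trans h2, h'⟩⟩
    · rintro ⟨h1, h2, h3, h4⟩
      exact ⟨⟨h1, h2, h3⟩, fun j hj h' => absurd (h4 j h'.1 hj) (not_lt.mpr h'.2.2)⟩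
  · refine ⟨fun h' => absurd h' (WithTop.top_ne_coe), ?_⟩
    rintro ⟨h1, h2, h3, -⟩
    exact absurd ⟨i, h1, h2, h3⟩ h

omit [MeasurableSpace Ω] in
lemma isFirst_threshold (a : ℝ) : IsFirst X N 0 a (threshold X N a) := by
  classical
  intro ω i
  rw [threshold]
  split_ifs with h
  · refine (WithTop.coe_injective.eq_iff (a := Nat.find h) (b := i)).trans ?_
    rw [Nat.find_eq_iff]
    constructor
    · rintro ⟨⟨h1, h2, h3⟩, h4⟩
      refine ⟨zero_le, h1, h3, fun j _ => ?_⟩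
      -- Minimality excludes only earlier candidates of value at least `a`. But an earlier value at
      -- least `a`, preceded only by values below `a`, would be a candidate.
      induction j using Nat.strong_induction_on with
      | _ j ih =>
        intro hj
        refine not_le.mp fun h' => h4 j hj ⟨hj.trans h1, fun l hl => ?_, h'⟩
        rcases hl.lt_or_eq with hl | rfl
        · exact ((ih l hl zero_le (hl.trans hj)).trans_le h').le
        · exact le_rfl
    · rintro ⟨-, h2, h3, h4⟩
      refine ⟨⟨h2, fun j hj => ?_, h3⟩, fun j hj h' =>
        absurd (h4 j zero_le hj) (not_lt.mpr h'.2.2)⟩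
      rcases hj.lt_or_eq with hj | rfl
      · exact ((h4 j zero_le hj).trans_le h3).le
      · exact le_rfl
  · refine ⟨fun h' => absurd h' (WithTop.top_ne_coe), ?_⟩
    rintro ⟨-, h2, h3, h4⟩
    refine absurd ⟨i, h2, fun j hj => ?_, h3⟩ h
    rcases hj.lt_or_eq with hj | rfl
    · exact ((h4 j zero_le hj).trans_le h3).le
    · exact le_rfl

/-- The integral of the stopping value over the values at least `a`. -/
def tailInt (Q : ℝ≥0∞) (a : ℝ) : ℝ≥0∞ := ∫⁻ y in Set.Ici a, stopFun Q y ∂unif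

/-- Stopping at stage `k + n` means `n` values below `a`, then one at least `a`, within the horizon.
By independence this contributes `Q ^ (n + k) * cdf01 a ^ n * tailInt Q a`, a geometric series in
`n`. -/
lemma Model.lintegral_gain_first (M : Model P X N Q) {k : ℕ} {a : ℝ} {τ : Ω → WithTop ℕ}
    (h : IsFirst X N k a τ) {K : ℕ → Ω → Prop}
    (hK : ∀ i, MeasurableSet[hist X M.measurable_X i] {ω | K i ω})
    (hτK : ∀ ω (i : ℕ), τ ω = WithTop.some i → K i ω) :
    ∫⁻ ω, gain X N K τ ω ∂P = Q ^ k * (stopFun Q a * tailInt Q a) := by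
  classical
  rw [M.lintegral_gain hK (h.isStoppingTime _ _)]
  have h0 (i : ℕ) (hi : i < k) : reward P X N Q K τ i = 0 := by
    have : stopAt K τ i = ∅ := by
      ext ω
      simp only [stopAt, h ω i, Set.mem_ofPred_eq, Set.mem_empty_iff_false, iff_false]
      omega
    simp [reward, this]
  have h1 (n : ℕ) : reward P X N Q K τ (n + k)
      = Q ^ k * tailInt Q a * (Q * cdf01 a) ^ n := by
    set φ : ℕ → ℝ → ℝ≥0∞ := fun j =>
      if j = n + k then (Set.Ici a).indicator (stopFun Q) else (Set.Iio a).indicator 1 with hφ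
    have hφm (j : ℕ) : Measurable (φ j) := by
      rw [hφ]
      dsimp only
      split_ifs
      · exact (measurable_stopFun Q).indicator measurableSet_Ici
      · exact measurable_one.indicator measurableSet_Iio
    have e : reward P X N Q K τ (n + k)
        = ∫⁻ ω, (∏ j ∈ Finset.Icc k (n + k), φ j (X j ω)) * avail N (n + k) ω ∂P := by
      refine lintegral_congr fun ω => ?_
      by_cases hω : n + k < N ω
      swap
      · simp [avail, hω]
      congr 1
      have hp : ∏ j ∈ Finset.Ico k (n + k), φ j (X j ω)
          = ∏ j ∈ Finset.Ico k (n + k), (Set.Iio a).indicator 1 (X j ω) :=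
        Finset.prod_congr rfl fun j hj => by
          simp [hφ, (Finset.mem_Ico.mp hj).2.ne]
      have hs : ω ∈ stopAt K τ (n + k) ↔ a ≤ X (n + k) ω ∧ ∀ j, k ≤ j → j < n + k → X j ω < a :=
        ⟨fun hm => ((h ω _).mp hm.1).2.2, fun hm =>
          have := (h ω _).mpr ⟨Nat.le_add_left _ _, hω, hm⟩
          ⟨this, hτK _ _ this⟩⟩
      rw [← Finset.prod_Ico_mul_eq_prod_Icc (Nat.le_add_left k n), hp]
      by_cases ha : a ≤ X (n + k) ω
      swap
      · have : ω ∉ stopAt K τ (n + k) := fun hm => ha (hs.mp hm).1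
        simp [this, hφ, ha]
      by_cases hj : ∀ j, k ≤ j → j < n + k → X j ω < a
      · have : ω ∈ stopAt K τ (n + k) := hs.mpr ⟨ha, hj⟩
        rw [Finset.prod_eq_one]
        · simp [this, hφ, ha]
        · intro j hj'
          have := Finset.mem_Ico.mp hj'
          simp [hj j this.1 this.2]
      · have : ω ∉ stopAt K τ (n + k) := fun hm => hj (hs.mp hm).2
        push Not at hj
        obtain ⟨j, hj1, hj2, hj3⟩ := hj
        rw [Finset.prod_eq_zero (Finset.mem_Ico.mpr ⟨hj1, hj2⟩)]
        · simp [this]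
        · simp [hj3]
    have hm : Measurable[hist X M.measurable_X (n + k)]
        fun ω => ∏ j ∈ Finset.Icc k (n + k), φ j (X j ω) :=
      Finset.measurable_prod _ fun j hj =>
        (hφm j).comp (measurable_hist _ (Finset.mem_Icc.mp hj).2)
    rw [e, M.lintegral_mul_avail hm, lintegral_prod_eq_prod_lintegral_of_indepFun _
      (fun j ω => φ j (X j ω)) (M.indep.comp φ hφm) fun j => (hφm j).comp (M.measurable_X j)]
    have hl (j : ℕ) : ∫⁻ ω, φ j (X j ω) ∂P = ∫⁻ y, φ j y ∂unif := by
      rw [← M.map_X j, lintegral_map (hφm j) (M.measurable_X j)]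
    simp_rw [hl]
    rw [← Finset.prod_Ico_mul_eq_prod_Icc (Nat.le_add_left k n)]
    have hp : ∏ j ∈ Finset.Ico k (n + k), ∫⁻ y, φ j y ∂unif = cdf01 a ^ n := by
      rw [Finset.prod_congr rfl (g := fun _ => cdf01 a), Finset.prod_const]
      · simp
      · intro j hj
        simp only [hφ, (Finset.mem_Ico.mp hj).2.ne, if_false]
        rw [lintegral_indicator_one measurableSet_Iio]; rfl
    rw [hp]
    simp only [hφ, if_true]
    rw [lintegral_indicator measurableSet_Ici, ← tailInt, pow_add, mul_pow]
    ring
  rw [← ENNReal.summable.sum_add_tsum_nat_add' (k := k),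
    Finset.sum_eq_zero fun i hi => h0 i (Finset.mem_range.mp hi), zero_add]
  simp_rw [h1]
  rw [ENNReal.tsum_mul_left, ENNReal.tsum_geometric, stopFun]
  ring

/-! ### The potential of a threshold rule -/

lemma stopFun_eq (Q : ℝ≥0∞) (x : ℝ) : stopFun Q x = 1 + Q * cdf01 x * stopFun Q x := by
  rw [stopFun, ← ENNReal.tsum_geometric, ← ENNReal.tsum_mul_left]
  conv_lhs => rw [tsum_eq_zero_add' ENNReal.summable]
  simp [pow_succ']

lemma tailInt_anti (Q : ℝ≥0∞) : Antitone (tailInt Q) := fun _ _ h =>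
  lintegral_mono_set (Set.Ici_subset_Ici.mpr h)

/-- The value of passing over a candidate of value `m` and then selecting the first object of
value at least `max m a`. -/
def potential (Q : ℝ≥0∞) (a m : ℝ) : ℝ≥0∞ := Q * tailInt Q (max m a) * stopFun Q (max m a)

lemma measurable_potential (Q : ℝ≥0∞) (a : ℝ) : Measurable (potential Q a) :=
  (((tailInt_anti Q).measurable.comp (by fun_prop)).const_mul _).mul
    ((measurable_stopFun Q).comp (by fun_prop))

lemma potential_le_stopFun {a x : ℝ} (ha : Q * tailInt Q a ≤ 1) (h : a ≤ x) :
    potential Q a x ≤ stopFun Q x := by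
  rw [potential, max_eq_left h]
  calc _ ≤ 1 * stopFun Q x := by
        gcongr
        exact le_trans (by gcongr; exact tailInt_anti Q h) ha
    _ = _ := one_mul _

lemma lintegral_split (b : ℝ) (c : ℝ≥0∞) :
    ∫⁻ y, (if y < b then c else stopFun Q y) ∂unif = c * cdf01 b + tailInt Q b := by
  have : (fun y => if y < b then c else stopFun Q y)
      = fun y => (Set.Iio b).indicator (fun _ => c) y + (Set.Ici b).indicator (stopFun Q) y := by
    ext y
    by_cases h : y < b
    · simp [h]
    · simp [h, not_lt.mp h]
  rw [this, lintegral_add_left (measurable_const.indicator measurableSet_Iio),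
    lintegral_indicator measurableSet_Iio, lintegral_indicator measurableSet_Ici,
    setLIntegral_const]
  rfl

/-- Below `b` the integrand is at most the constant `potential Q a m`, above it at most `stopFun`;
the recursion `stopFun_eq` then gives back exactly `potential Q a m`. Only an almost sure `hS` is
asked for, which makes it automatic when `a = 0`. -/
lemma potential_excessive {a : ℝ} (ha : Q * tailInt Q a ≤ 1)
    (hS : ∀ᵐ y ∂unif, y < a → stopFun Q y ≤ potential Q a a) (m : ℝ) :
    Q * ∫⁻ y, (if m ≤ y then max (stopFun Q y) (potential Q a y) else potential Q a m) ∂unif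
      ≤ potential Q a m := by
  set b := max m a with hb
  have hc {y : ℝ} (h : y < a) : potential Q a y = potential Q a a := by
    rw [potential, potential, max_eq_right h.le, max_self]
  calc _ ≤ Q * ∫⁻ y, (if y < b then potential Q a m else stopFun Q y) ∂unif := by
        gcongr 1
        refine lintegral_mono_ae ?_
        filter_upwards [hS] with y hy
        by_cases h1 : m ≤ y
        · simp only [h1, if_true]
          by_cases h2 : y < a
          · have h3 : y < b := h2.trans_le (le_max_right _ _)
            rw [if_pos h3, hc h2, hc (h1.trans_lt h2), max_eq_right (hy h2)]
          · have h3 : ¬ y < b := not_lt.mpr (max_le h1 (not_lt.mp h2))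
            rw [if_neg h3, max_eq_left (potential_le_stopFun ha (not_lt.mp h2))]
        · have h3 : y < b := (not_le.mp h1).trans_le (le_max_left _ _)
          simp [h1, h3]
    _ = Q * tailInt Q b * (1 + Q * cdf01 b * stopFun Q b) := by
        rw [lintegral_split, potential, ← hb]; ring
    _ = potential Q a m := by rw [← stopFun_eq, potential]

/-! ### Bounds on the continuation value and the value of the problem -/

/-- The running maximum from stage `k` on, started at `z`. -/
def runMax (X : ℕ → Ω → ℝ) (k : ℕ) (z : Ω → ℝ) : ℕ → Ω → ℝ
  | 0 => z
  | n + 1 => if k ≤ n then fun ω => max (runMax X k z n ω) (X (n + 1) ω) else z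

omit [MeasurableSpace Ω] in
lemma runMax_self (k : ℕ) (z : Ω → ℝ) : runMax X k z k = z := by
  cases k <;> simp [runMax]

omit [MeasurableSpace Ω] in
lemma runMax_succ {k n : ℕ} (h : k ≤ n) (z : Ω → ℝ) (ω : Ω) :
    runMax X k z (n + 1) ω = max (runMax X k z n ω) (X (n + 1) ω) := by
  simp [runMax, h]

omit [MeasurableSpace Ω] in
lemma runMax_le {k n : ℕ} (h : k ≤ n) {z : Ω → ℝ} {ω : Ω} {c : ℝ} (hz : z ω ≤ c)
    (hX : ∀ l, k < l → l ≤ n → X l ω ≤ c) : runMax X k z n ω ≤ c := by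
  induction n, h using Nat.le_induction with
  | base => rwa [runMax_self]
  | succ n hn ih =>
    rw [runMax_succ hn]
    exact max_le (ih fun l h1 h2 => hX l h1 (by omega)) (hX _ (by omega) le_rfl)

/-- The event that `j` is a candidate when the running maximum at stage `k` is `x`. -/
def ContCandidate (X : ℕ → Ω → ℝ) (k : ℕ) (x : ℝ) (j : ℕ) (ω : Ω) : Prop :=
  x ≤ X j ω ∧ ∀ l, k < l → l ≤ j → X l ω ≤ X j ω

namespace Model

variable (M : Model P X N Q)
include M

omit [IsProbabilityMeasure P] in
lemma measurableSet_candidate (i : ℕ) :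
    MeasurableSet[hist X M.measurable_X i] {ω | IsCandidate X i ω} := by
  have : {ω | IsCandidate X i ω} = ⋂ j ∈ Finset.range (i + 1), {ω | X j ω ≤ X i ω} := by
    ext ω; simp [IsCandidate]
  rw [this]
  refine Finset.measurableSet_biInter _ fun j hj => ?_
  exact measurableSet_le (measurable_hist _ (Nat.lt_succ_iff.mp (Finset.mem_range.mp hj)))
    (measurable_hist _ le_rfl)

omit [IsProbabilityMeasure P] in
lemma measurableSet_contCandidate (k : ℕ) (x : ℝ) (i : ℕ) :
    MeasurableSet[hist X M.measurable_X i] {ω | ContCandidate X k x i ω} := by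
  have : {ω | ContCandidate X k x i ω} = {ω | x ≤ X i ω} ∩
      ⋂ j ∈ Finset.Ioc k i, {ω | X j ω ≤ X i ω} := by
    ext ω; simp [ContCandidate]
  rw [this]
  have hi := measurable_hist M.measurable_X (le_refl i)
  refine MeasurableSet.inter (measurableSet_le measurable_const hi)
    (Finset.measurableSet_biInter _ fun j hj => ?_)
  exact measurableSet_le (measurable_hist _ (Finset.mem_Ioc.mp hj).2) hi

omit [IsProbabilityMeasure P] in
/-- Expectations given that object `k` is available, of functions vanishing otherwise. -/
lemma lintegral_cond (hQ0 : Q ≠ 0) (hQ : Q ≠ ∞) (k : ℕ) {f : Ω → ℝ≥0∞} {c : ℝ≥0∞}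
    (h : ∫⁻ ω, avail N k ω * f ω ∂P = Q ^ k * c) : ∫⁻ ω, f ω ∂P[|{ω | k < N ω}] = c := by
  have hs : MeasurableSet {ω | k < N ω} := M.measurable_N measurableSet_Ioi
  have : ∫⁻ ω, avail N k ω * f ω ∂P = ∫⁻ ω in {ω | k < N ω}, f ω ∂P := by
    rw [← lintegral_indicator hs]
    refine lintegral_congr fun ω => ?_
    by_cases hω : k < N ω <;> simp [avail, hω]
  rw [ProbabilityTheory.cond, lintegral_smul_measure, ← this, h, M.tail, smul_eq_mul,
    ← mul_assoc, ENNReal.inv_mul_cancel (pow_ne_zero _ hQ0) (ENNReal.pow_ne_top hQ), one_mul]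

lemma stopValue_eq (hQ0 : Q ≠ 0) (hQ : Q ≠ ∞) (k : ℕ) (x : ℝ) :
    stopValue P X N k x = stopFun Q x := by
  refine M.lintegral_cond hQ0 hQ k ?_
  have := M.lintegral_mul_duration (k := k) (f := fun _ => 1) (Y := fun _ => x)
    measurable_const measurable_const
  simpa using this

omit M [MeasurableSpace Ω] in
-- The factor `avail N k` is harmless: a positive payoff needs `k < τ < N`.
lemma contPayoff_eq {k : ℕ} {x : ℝ} {τ : Ω → WithTop ℕ} (hk : ∀ ω, (k : WithTop ℕ) < τ ω) (ω : Ω) :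
    avail N k ω * contPayoff X N k x τ ω = gain X N (ContCandidate X k x) τ ω := by
  classical
  have e : contPayoff X N k x τ ω = gain X N (ContCandidate X k x) τ ω := by
    unfold contPayoff gain ContCandidate
    congr!
  rw [e]
  by_cases h : k < N ω
  · simp [avail, h]
  · have : gain X N (ContCandidate X k x) τ ω = 0 := by
      rw [gain_eq_tsum]
      refine ENNReal.tsum_eq_zero.mpr fun i => ?_
      by_cases hi : i < N ω
      · have : ω ∉ stopAt (ContCandidate X k x) τ i := fun h' => by
          have h2 : WithTop.some k < WithTop.some i := h'.1 ▸ hk ω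
          have := WithTop.coe_lt_coe.mp h2
          omega
        simp [this]
      · simp [avail, hi]
    simp [this]

/-- `tsum_reward_le` is applied to the running maximum started at the constant `x` at stage `k`;
rewards up to stage `k` vanish because `τ > k`. -/
lemma contValue_le (hQ0 : Q ≠ 0) (hQ : Q ≠ ∞) {a : ℝ} (ha : Q * tailInt Q a ≤ 1)
    (hS : ∀ᵐ y ∂unif, y < a → stopFun Q y ≤ potential Q a a) (k : ℕ) (x : ℝ) :
    contValue P X N M.measurable_X M.measurable_N k x ≤ potential Q a x := by
  refine iSup₂_le fun τ ⟨hτ, hk⟩ => ?_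
  have h := M.tsum_reward_le (measurable_potential Q a) (potential_excessive ha hS)
    (K := ContCandidate X k x) hτ (k := k) (Z := runMax X k fun _ => x)
    (by rw [runMax_self]; exact measurable_const) (fun n hn ω => runMax_succ hn _ ω)
    (fun n hn ω hK => runMax_le hn hK.1 fun l h1 h2 => hK.2 l h1 (by omega))
  rw [runMax_self] at h
  have h2 : ∫⁻ ω, gain X N (ContCandidate X k x) τ ω ∂P ≤ Q ^ k * potential Q a x := by
    rw [M.lintegral_gain (M.measurableSet_contCandidate k x) hτ,
      ← ENNReal.summable.sum_add_tsum_nat_add' (k := k + 1), Finset.sum_eq_zero, zero_add]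
    · refine h.trans ?_
      have := M.lintegral_mul_avail (j := 0) (f := fun _ => potential Q a x) measurable_const k
      rw [lintegral_const, measure_univ, mul_one] at this
      rw [← this]
      gcongr with ω
      rw [Set.indicator_apply]
      split_ifs <;> simp
    · intro i hi
      have : stopAt (ContCandidate X k x) τ i = ∅ := by
        ext ω
        simp only [Set.mem_empty_iff_false, iff_false]
        intro h'
        have h2 : WithTop.some k < WithTop.some i := h'.1 ▸ hk ω
        have := WithTop.coe_lt_coe.mp h2
        have := Finset.mem_range.mp hi
        omega
      simp [reward, this]
  obtain ⟨c, hc⟩ : ∃ c, ∫⁻ ω, gain X N (ContCandidate X k x) τ ω ∂P = Q ^ k * c :=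
    ⟨(Q ^ k)⁻¹ * ∫⁻ ω, gain X N (ContCandidate X k x) τ ω ∂P, by
      rw [← mul_assoc, ENNReal.mul_inv_cancel (pow_ne_zero _ hQ0) (ENNReal.pow_ne_top hQ), one_mul]⟩
  rw [M.lintegral_cond hQ0 hQ k (c := c) (by simp_rw [contPayoff_eq hk, hc])]
  rw [hc] at h2
  exact (ENNReal.mul_le_mul_iff_right (pow_ne_zero _ hQ0) (ENNReal.pow_ne_top hQ)).mp h2

/-- The witness takes the first value at least `a` after stage `k`. As `x ≤ a`, the selected object
is always a candidate. -/
lemma le_contValue (hQ0 : Q ≠ 0) (hQ : Q ≠ ∞) {a x : ℝ} (k : ℕ) (hx : x ≤ a) :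
    Q * tailInt Q a * stopFun Q a ≤ contValue P X N M.measurable_X M.measurable_N k x := by
  have hf := isFirst_firstFrom (X := X) (N := N) (k + 1) a
  have hk (ω : Ω) : WithTop.some k < firstFrom X N (k + 1) a ω := by
    rcases h : firstFrom X N (k + 1) a ω with _ | i
    · exact WithTop.coe_lt_top k
    · have := ((hf ω i).mp h).1
      exact WithTop.coe_lt_coe.mpr this
  have h := M.lintegral_gain_first hf (M.measurableSet_contCandidate k x) fun ω i hi => by
    obtain ⟨h1, h2, h3, h4⟩ := (hf ω i).mp hi
    refine ⟨hx.trans h3, fun l hl hli => ?_⟩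
    rcases hli.lt_or_eq with hli | rfl
    · exact ((h4 l hl hli).trans_le h3).le
    · exact le_rfl
  refine le_trans (le_of_eq ?_) (le_iSup₂ (f := fun (τ : Ω → WithTop ℕ) (_ : IsStoppingTime
    (info X N M.measurable_X M.measurable_N) τ ∧ ∀ ω, (k : WithTop ℕ) < τ ω) =>
    ∫⁻ ω, contPayoff X N k x τ ω ∂P[|{ω | k < N ω}]) (firstFrom X N (k + 1) a)
    ⟨hf.isStoppingTime _ _, hk⟩)
  refine (M.lintegral_cond hQ0 hQ k ?_).symm
  simp_rw [contPayoff_eq hk, h, pow_succ]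
  ring

omit M [MeasurableSpace Ω] in
lemma payoff_eq (τ : Ω → WithTop ℕ) (ω : Ω) : payoff X N τ ω = gain X N (IsCandidate X) τ ω := by
  unfold payoff gain
  congr!

/-- Stage `0` is split off, as its object is always a candidate. Stopping there earns `stopFun`,
going on at most the potential at `X 0`; the maximum of the two is then integrated. -/
lemma value_le {a : ℝ} (ha : Q * tailInt Q a ≤ 1)
    (hS : ∀ᵐ y ∂unif, y < a → stopFun Q y ≤ potential Q a a) :
    value P X N M.measurable_X M.measurable_N
      ≤ potential Q a a * cdf01 a + tailInt Q a := by
  classical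
  refine iSup₂_le fun τ hτ => ?_
  have h := M.tsum_reward_le (measurable_potential Q a) (potential_excessive ha hS)
    (K := IsCandidate X) hτ (k := 0) (Z := runMax X 0 (X 0))
    (by rw [runMax_self]; exact measurable_hist _ le_rfl) (fun n hn ω => runMax_succ hn _ ω)
    (fun n hn ω hK => runMax_le hn (hK 0 (by omega)) fun l h1 h2 => hK l (by omega))
  rw [runMax_self] at h
  simp_rw [payoff_eq]
  rw [M.lintegral_gain M.measurableSet_candidate hτ, tsum_eq_zero_add' ENNReal.summable]
  calc _ ≤ ∫⁻ ω, max (stopFun Q (X 0 ω)) (potential Q a (X 0 ω)) ∂P := by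
        refine (add_le_add_right h _).trans ((le_lintegral_add _ _).trans
          (lintegral_mono fun ω => ?_))
        by_cases h0 : 0 < N ω
        swap
        · simp [avail, h0]
        simp only [avail, h0, if_true, mul_one]
        by_cases h1 : τ ω = WithTop.some 0
        · have h3 : ω ∉ {ω | WithTop.some 0 < τ ω} := by
            change ¬ WithTop.some 0 < τ ω
            rw [h1]; exact lt_irrefl _
          rw [Set.indicator_of_notMem h3, zero_mul, add_zero, Set.indicator_apply]
          split_ifs <;> simp
        · have h3 : ω ∉ stopAt (IsCandidate X) τ 0 := fun h => h1 h.1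
          rw [Set.indicator_of_notMem h3, zero_mul, zero_add, Set.indicator_apply]
          split_ifs <;> simp
    _ = ∫⁻ y, max (stopFun Q y) (potential Q a y) ∂unif := by
        rw [← M.map_X 0, lintegral_map ((measurable_stopFun Q).max (measurable_potential Q a))
          (M.measurable_X 0)]
    _ ≤ ∫⁻ y, (if y < a then potential Q a a else stopFun Q y) ∂unif := by
        refine lintegral_mono_ae ?_
        filter_upwards [hS] with y hy
        by_cases h2 : y < a
        · have : potential Q a y = potential Q a a := by
            rw [potential, potential, max_eq_right h2.le, max_self]
          rw [if_pos h2, this, max_eq_right (hy h2)]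
        · rw [if_neg h2, max_eq_left (potential_le_stopFun ha (not_lt.mp h2))]
    _ = _ := lintegral_split _ _

lemma lintegral_payoff_threshold (a : ℝ) :
    ∫⁻ ω, payoff X N (threshold X N a) ω ∂P = stopFun Q a * tailInt Q a := by
  have hf := isFirst_threshold (X := X) (N := N) a
  have h := M.lintegral_gain_first hf M.measurableSet_candidate fun ω i hi => by
    obtain ⟨h1, h2, h3, h4⟩ := (hf ω i).mp hi
    intro l hli
    rcases hli.lt_or_eq with hli | rfl
    · exact ((h4 l zero_le hli).trans_le h3).le
    · exact le_rfl
  simp_rw [payoff_eq, h, pow_zero, one_mul]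

lemma lintegral_payoff_zero :
    ∫⁻ ω, payoff X N (fun _ => 0) ω ∂P = ∫⁻ y, stopFun Q y ∂unif := by
  have hτ := isStoppingTime_const (info X N M.measurable_X M.measurable_N) 0
  simp_rw [payoff_eq]
  refine (M.lintegral_gain M.measurableSet_candidate hτ).trans ?_
  rw [tsum_eq_single 0]
  · have (ω : Ω) : ω ∈ stopAt (IsCandidate X) (fun _ => WithTop.some 0) 0 :=
      ⟨rfl, fun j hj => by rw [Nat.le_zero.mp hj]⟩
    have h2 := M.lintegral_mul_avail (j := 0) (f := fun ω => stopFun Q (X 0 ω))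
      ((measurable_stopFun Q).comp (measurable_hist _ le_rfl)) 0
    rw [pow_zero, one_mul] at h2
    rw [← M.map_X 0, lintegral_map (measurable_stopFun Q) (M.measurable_X 0), ← h2]
    refine lintegral_congr fun ω => ?_
    rw [Set.indicator_of_mem (this ω), Pi.one_apply, one_mul]
  · intro i hi
    have : stopAt (IsCandidate X) (fun _ : Ω => WithTop.some 0) i = ∅ := by
      ext ω
      simp only [Set.mem_empty_iff_false, iff_false]
      intro h'
      exact hi (WithTop.coe_injective h'.1).symm
    change reward P X N Q (IsCandidate X) (fun _ : Ω => WithTop.some 0) i = 0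
    rw [reward, this]
    simp

end Model

end GeomDuration
end

/-! ### Explicit formulas for the uniform and geometric laws -/

noncomputable section

namespace GeomDuration

/-- For negative `x` both sides vanish, by truncation in `ENNReal.ofReal`. -/
lemma cdf01_eq {x : ℝ} (h1 : x ≤ 1) : cdf01 x = ENNReal.ofReal x := by
  have : Set.Iio x ∩ Set.Icc 0 1 = Set.Ico 0 x := by
    ext y
    simp only [Set.mem_inter_iff, Set.mem_Iio, Set.mem_Icc, Set.mem_Ico]
    exact ⟨fun h => ⟨h.2.1, h.1⟩, fun h => ⟨h.2, h.1, by linarith⟩⟩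
  rw [cdf01, unif, Measure.restrict_apply measurableSet_Iio, this, Real.volume_Ico, sub_zero]

lemma stopFun_eq_ofReal {q x : ℝ} (hq0 : 0 < q) (hq1 : q < 1) (h0 : 0 ≤ x) (h1 : x ≤ 1) :
    stopFun (ENNReal.ofReal q) x = ENNReal.ofReal (1 / (1 - q * x)) := by
  have h : 0 < 1 - q * x := by nlinarith
  rw [stopFun, cdf01_eq h1, ← ENNReal.ofReal_mul hq0.le, ← ENNReal.ofReal_one,
    ← ENNReal.ofReal_sub _ (by positivity), ← ENNReal.ofReal_inv_of_pos h, one_div]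

lemma tailInt_eq_ofReal {q a : ℝ} (hq0 : 0 < q) (hq1 : q < 1) (h0 : 0 ≤ a) (h1 : a ≤ 1) :
    tailInt (ENNReal.ofReal q) a
      = ENNReal.ofReal (1 / q * Real.log ((1 - q * a) / (1 - q))) := by
  have hpos {x : ℝ} (hx : x ≤ 1) : 0 < 1 - q * x := by nlinarith
  have hset : Set.Ici a ∩ Set.Icc 0 1 = Set.Icc a 1 := by
    ext y
    simp only [Set.mem_inter_iff, Set.mem_Ici, Set.mem_Icc]
    exact ⟨fun h => ⟨h.1, h.2.2⟩, fun h => ⟨h.1, by linarith, h.2⟩⟩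
  have hcont : ContinuousOn (fun x => 1 / (1 - q * x)) (Set.Icc a 1) :=
    ContinuousOn.div (by fun_prop) (by fun_prop) fun x hx => (hpos hx.2).ne'
  have hint : ∫ x in a..1, 1 / (1 - q * x) = 1 / q * Real.log ((1 - q * a) / (1 - q)) := by
    rw [intervalIntegral.integral_eq_sub_of_hasDerivAt
      (f := fun x => -(1 / q) * Real.log (1 - q * x))]
    · rw [Real.log_div (hpos h1).ne' (by linarith)]; ring_nf
    · intro x hx
      rw [Set.uIcc_of_le h1] at hx
      have hd : HasDerivAt (fun x => 1 - q * x) (-q) x := by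
        simpa using ((hasDerivAt_id x).const_mul q).const_sub 1
      have := (hd.log (hpos hx.2).ne').const_mul (-(1 / q))
      rwa [show -(1 / q) * (-q / (1 - q * x)) = 1 / (1 - q * x) by
        rw [neg_div, neg_mul_neg, one_div_mul_eq_div, div_right_comm, div_self hq0.ne']] at this
    · exact (hcont.mono (by rw [Set.uIcc_of_le h1])).intervalIntegrable
  rw [tailInt, unif, Measure.restrict_restrict measurableSet_Ici, hset, ← hint,
    intervalIntegral.integral_of_le h1, ← integral_Icc_eq_integral_Ioc,
    ofReal_integral_eq_lintegral_ofReal hcont.integrableOn_Icc]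
  · refine setLIntegral_congr_fun measurableSet_Icc fun x hx => ?_
    exact stopFun_eq_ofReal hq0 hq1 (h0.trans hx.1) hx.2
  · refine (ae_restrict_mem measurableSet_Icc).mono fun x hx => ?_
    have := hpos hx.2
    simp only [Pi.zero_apply]
    positivity

lemma map_eq_unif {Ω : Type*} [MeasurableSpace Ω] {P : Measure Ω} {Y : Ω → ℝ}
    (h : pdf.IsUniform Y (Set.Icc (0 : ℝ) 1) P volume) : P.map Y = unif := by
  rw [pdf.IsUniform] at h
  rw [h, ProbabilityTheory.cond, unif]
  simp

lemma measure_lt_of_geometric {Ω : Type*} [MeasurableSpace Ω] {P : Measure Ω} {N : Ω → ℕ}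
    {p q : ℝ} (hp0 : 0 < p) (hp1 : p < 1) (hq : q = 1 - p) (hN : Measurable N)
    (hgeom : ∀ k : ℕ, P {ω | N ω = k + 1} = ENNReal.ofReal (p * q ^ k)) (n : ℕ) :
    P {ω | n < N ω} = ENNReal.ofReal q ^ n := by
  have hq0 : 0 ≤ q := by linarith
  have : {ω | n < N ω} = ⋃ i : ℕ, {ω | N ω = (n + i) + 1} := by
    ext ω
    simp only [Set.mem_ofPred_eq, Set.mem_iUnion]
    exact ⟨fun h => ⟨N ω - n - 1, by omega⟩, by rintro ⟨i, hi⟩; omega⟩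
  rw [this, measure_iUnion]
  · have (i : ℕ) : P {ω | N ω = (n + i) + 1}
        = ENNReal.ofReal q ^ n * ENNReal.ofReal p * ENNReal.ofReal q ^ i := by
      rw [hgeom, ENNReal.ofReal_mul hp0.le, ENNReal.ofReal_pow hq0, pow_add]
      ring
    simp_rw [this]
    rw [ENNReal.tsum_mul_left, ENNReal.tsum_geometric]
    have : 1 - ENNReal.ofReal q = ENNReal.ofReal p := by
      rw [← ENNReal.ofReal_one, ← ENNReal.ofReal_sub _ hq0]
      congr 1; linarith
    rw [this, mul_assoc, ENNReal.mul_inv_cancel (by simpa using hp0) ENNReal.ofReal_ne_top, mul_one]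
  · intro i j hij
    refine Set.disjoint_left.mpr fun ω h1 h2 => hij ?_
    simp only [Set.mem_ofPred_eq] at h1 h2
    omega
  · exact fun i => hN (measurableSet_singleton _)

end GeomDuration

end

/-! ### The two regimes of `p` -/

theorem mainTheorem4 {Ω : Type*} [MeasurableSpace Ω] (P : Measure Ω) [IsProbabilityMeasure P]
    (X : ℕ → Ω → ℝ) (N : Ω → ℕ) (p q : ℝ) (hp0 : 0 < p) (hp1 : p < 1) (hq : q = 1 - p)
    (hX : ∀ i, Measurable (X i)) (hN : Measurable N)
    (hunif : ∀ i, pdf.IsUniform (X i) (Set.Icc (0 : ℝ) 1) P volume)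
    (hindep : iIndepFun X P)
    (hgeom : ∀ k : ℕ, P {ω | N ω = k + 1} = ENNReal.ofReal (p * q ^ k))
    (hNX : IndepFun N (fun ω i => X i ω) P) :
    (p ≤ Real.exp (-1) →
      ∀ x₀ : ℝ, x₀ = (1 - Real.exp 1 * p) / q →
        0 ≤ x₀ ∧ x₀ < 1 ∧ (p < Real.exp (-1) → 0 < x₀) ∧
        GeomDuration.stoppingRegion P X N hX hN = {s ∈ GeomDuration.states | x₀ ≤ s.2} ∧
        GeomDuration.IsOptimal P X N hX hN (GeomDuration.threshold X N x₀) ∧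
        GeomDuration.value P X N hX hN =
          ENNReal.ofReal (x₀ / (1 - q * x₀) - 1 / q * Real.log ((1 - q) / (1 - q * x₀)))) ∧
    (Real.exp (-1) < p →
      GeomDuration.stoppingRegion P X N hX hN = GeomDuration.states ∧
      GeomDuration.IsOptimal P X N hX hN (fun _ => 0) ∧
      GeomDuration.value P X N hX hN = ENNReal.ofReal (-(1 / q) * Real.log (1 - q))) := by
  have hq0 : 0 < q := by linarith
  have hq1 : q < 1 := by linarith
  have M : GeomDuration.Model P X N (ENNReal.ofReal q) :=
    ⟨hX, hN, fun i => GeomDuration.map_eq_unif (hunif i), hindep,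
      GeomDuration.measure_lt_of_geometric hp0 hp1 hq hN hgeom, hNX⟩
  set Q := ENNReal.ofReal q with hQdef
  have hQ0 : Q ≠ 0 := by simpa [hQdef] using hq0
  have hQt : Q ≠ ∞ := ENNReal.ofReal_ne_top
  have hexp : Real.exp 1 * Real.exp (-1) = 1 := by rw [← Real.exp_add]; simp
  have he : 0 < Real.exp 1 := Real.exp_pos 1
  constructor
  · intro hp x₀ hx₀
    have hqx : 1 - q * x₀ = Real.exp 1 * p := by rw [hx₀]; field_simp; ring
    have hep : Real.exp 1 * p ≤ 1 := (mul_le_mul_of_nonneg_left hp he.le).trans_eq hexp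
    have h0 : 0 ≤ x₀ := hx₀ ▸ div_nonneg (by linarith) hq0.le
    have h1 : x₀ < 1 := by
      have : 1 < Real.exp 1 := by simp
      nlinarith
    have hT : GeomDuration.tailInt Q x₀ = ENNReal.ofReal (1 / q) := by
      rw [GeomDuration.tailInt_eq_ofReal hq0 hq1 h0 h1.le, hqx]
      have : Real.exp 1 * p / (1 - q) = Real.exp 1 := by
        rw [show 1 - q = p by linarith]; field_simp
      rw [this, Real.log_exp, mul_one]
    -- This equation determines `x₀`: passing over a candidate of value `x₀` and stopping on it are
    -- equally good.
    have hQT : Q * GeomDuration.tailInt Q x₀ = 1 := by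
      rw [hT, hQdef, ← ENNReal.ofReal_mul hq0.le, mul_one_div_cancel hq0.ne', ENNReal.ofReal_one]
    have hpot : GeomDuration.potential Q x₀ x₀ = GeomDuration.stopFun Q x₀ := by
      rw [GeomDuration.potential, max_self, hQT, one_mul]
    have hS : ∀ᵐ y ∂GeomDuration.unif, y < x₀ →
        GeomDuration.stopFun Q y ≤ GeomDuration.potential Q x₀ x₀ :=
      Filter.Eventually.of_forall fun y hy => by
        rw [hpot]; exact GeomDuration.stopFun_mono Q hy.le
    have hup := M.value_le hQT.le hS
    -- The left side is the payoff of the threshold rule, the right side the upper bound `hup`; they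
    -- agree because `Q * tailInt Q x₀ = 1`.
    have hval : GeomDuration.stopFun Q x₀ * GeomDuration.tailInt Q x₀ =
        GeomDuration.stopFun Q x₀ * GeomDuration.cdf01 x₀ + GeomDuration.tailInt Q x₀ := by
      conv_lhs => rw [GeomDuration.stopFun_eq]
      calc _ = GeomDuration.tailInt Q x₀ + (Q * GeomDuration.tailInt Q x₀) *
            (GeomDuration.stopFun Q x₀ * GeomDuration.cdf01 x₀) := by ring
        _ = _ := by rw [hQT, one_mul, add_comm]
    have hst := (GeomDuration.isFirst_threshold (X := X) (N := N) x₀).isStoppingTime hX hN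
    have hlow : ∫⁻ ω, GeomDuration.payoff X N (GeomDuration.threshold X N x₀) ω ∂P
        ≤ GeomDuration.value P X N hX hN :=
      le_iSup₂ (f := fun (τ : Ω → WithTop ℕ)
        (_ : IsStoppingTime (GeomDuration.info X N hX hN) τ) =>
        ∫⁻ ω, GeomDuration.payoff X N τ ω ∂P) _ hst
    have hopt : ∫⁻ ω, GeomDuration.payoff X N (GeomDuration.threshold X N x₀) ω ∂P
        = GeomDuration.value P X N hX hN := by
      refine le_antisymm hlow (hup.trans (le_of_eq ?_))
      rw [M.lintegral_payoff_threshold, hval, hpot]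
    refine ⟨h0, h1, fun hlt => ?_, ?_, ⟨hst, hopt⟩, ?_⟩
    · rw [hx₀]
      have : Real.exp 1 * p < 1 := (mul_lt_mul_of_pos_left hlt he).trans_eq hexp
      exact div_pos (by linarith) hq0
    · ext ⟨k, x⟩
      simp only [GeomDuration.stoppingRegion, GeomDuration.states, Set.mem_ofPred_eq]
      refine and_congr_right fun hx => ?_
      rw [M.stopValue_eq hQ0 hQt]
      constructor
      · intro h
        by_contra! hlt
        -- Below `x₀`, waiting for a value at least `x₀` is worth `stopFun Q x₀`, strictly more than
        -- stopping at `x`.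
        have h2 := (M.le_contValue hQ0 hQt k hlt.le).trans h
        rw [hQT, one_mul, GeomDuration.stopFun_eq_ofReal hq0 hq1 h0 h1.le,
          GeomDuration.stopFun_eq_ofReal hq0 hq1 hx.1 hx.2] at h2
        have h3 : 0 < 1 - q * x₀ := by rw [hqx]; positivity
        have h4 : 1 - q * x₀ < 1 - q * x := by nlinarith
        have h5 : 0 < 1 - q * x := h3.trans h4
        rw [ENNReal.ofReal_le_ofReal_iff (by positivity)] at h2
        exact absurd h2 (not_le.mpr (one_div_lt_one_div_of_lt h3 h4))
      · intro h
        exact (M.contValue_le hQ0 hQt hQT.le hS k x).trans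
          (GeomDuration.potential_le_stopFun hQT.le h)
    · have h3 : 0 < 1 - q * x₀ := by rw [hqx]; positivity
      have hlog : 0 ≤ Real.log ((1 - q * x₀) / (1 - q)) := by
        refine Real.log_nonneg ((one_le_div (by linarith)).mpr (by nlinarith))
      rw [← hopt, M.lintegral_payoff_threshold, hval,
        GeomDuration.stopFun_eq_ofReal hq0 hq1 h0 h1.le, GeomDuration.cdf01_eq h1.le,
        GeomDuration.tailInt_eq_ofReal hq0 hq1 h0 h1.le, ← ENNReal.ofReal_mul (by positivity),
        ← ENNReal.ofReal_add (by positivity) (by positivity)]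
      congr 1
      rw [← inv_div (1 - q * x₀) (1 - q), Real.log_inv]
      ring
  · intro hp
    have hT : GeomDuration.tailInt Q 0 = ENNReal.ofReal (-(1 / q) * Real.log (1 - q)) := by
      rw [GeomDuration.tailInt_eq_ofReal hq0 hq1 le_rfl zero_le_one, mul_zero, sub_zero, one_div
        (1 - q), Real.log_inv]
      congr 1; ring
    have hlog : -Real.log (1 - q) < 1 := by
      rw [show 1 - q = p by linarith]
      have := (Real.lt_log_iff_exp_lt hp0).mpr hp
      linarith
    have hQT : Q * GeomDuration.tailInt Q 0 ≤ 1 := by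
      rw [hT, hQdef, ← ENNReal.ofReal_mul hq0.le, ← ENNReal.ofReal_one]
      refine ENNReal.ofReal_le_ofReal ?_
      rw [show q * (-(1 / q) * Real.log (1 - q)) = -Real.log (1 - q) by field_simp]
      exact hlog.le
    -- Negative values have probability zero, so the threshold `a = 0` is admissible.
    have hS : ∀ᵐ y ∂GeomDuration.unif, y < 0 →
        GeomDuration.stopFun Q y ≤ GeomDuration.potential Q 0 0 := by
      refine (ae_restrict_mem measurableSet_Icc).mono fun y hy h => ?_
      exact absurd hy.1 (not_le.mpr h)
    have hup := M.value_le hQT hS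
    rw [GeomDuration.cdf01_eq zero_le_one, ENNReal.ofReal_zero, mul_zero, zero_add] at hup
    have hst := isStoppingTime_const (GeomDuration.info X N hX hN) 0
    have hlow : ∫⁻ ω, GeomDuration.payoff X N (fun _ => 0) ω ∂P
        ≤ GeomDuration.value P X N hX hN :=
      le_iSup₂ (f := fun (τ : Ω → WithTop ℕ)
        (_ : IsStoppingTime (GeomDuration.info X N hX hN) τ) =>
        ∫⁻ ω, GeomDuration.payoff X N τ ω ∂P) _ hst
    have hge : GeomDuration.tailInt Q 0 ≤ ∫⁻ ω, GeomDuration.payoff X N (fun _ => 0) ω ∂P := by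
      rw [M.lintegral_payoff_zero]
      exact setLIntegral_le_lintegral _ _
    refine ⟨?_, ⟨hst, le_antisymm hlow (hup.trans hge)⟩, ?_⟩
    · ext ⟨k, x⟩
      simp only [GeomDuration.stoppingRegion, Set.mem_ofPred_eq, and_iff_left_iff_imp]
      intro hx
      rw [M.stopValue_eq hQ0 hQt]
      exact (M.contValue_le hQ0 hQt hQT hS k x).trans
        (GeomDuration.potential_le_stopFun hQT hx.1)
    · rw [← hT]
      exact le_antisymm hup (hge.trans hlow)
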